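/- Let $p,q\ge 1$ be integers, let $n=p+q$ and $X=\{1,\dots,n\}\cup\{-1,\dots,-n\}$, and let $\gamma$ be the permutation $$\gamma=(1,\dots,p,-1,\dots,-p)\,(p+1,\dots,n,-(p+1),\dots,-n)$$ of $X$ (in cycle notation). For permutations $\sigma,\tau$ of $X$ write $\#(\tau)$ for the number of orbits of $\tau$ on $X$ (fixed points included) and $\#(\tau,\sigma)$ for the number of orbits on $X$ of the group generated by $\tau$ and $\sigma$. Let $$\mathcal S_{nc}(X,\gamma)=\{\tau\in\mathcal S(X) : \#(\tau)+\#(\tau^{-1}\gamma)+\#(\gamma)=|X|+2\,\#(\tau,\gamma)\}$$ be the set of non-crossing permutations of $X$ with respect to $\gamma$. Let $D_n$ be the group of the even permutations $\tau$ of $X$ with $\tau(-i)=-\tau(i)$ for all $i\in X$; one has $\gamma\in D_n$. For $\tau\in D_n$ let $\ell_D(\tau)$ be the smallest $k\ge 0$ such that $\tau$ is a product of $k$ elements of the generating set $$\{(i,j)(-i,-j) : 1\le i<j\le n\}\cup\{(i,-j)(-i,j) : 1\le i<j\le n\}$$ of $D_n$, and for $\sigma,\tau\in D_n$ put $\sigma\le\tau$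 if and only if $\ell_D(\tau)=\ell_D(\sigma)+\ell_D(\sigma^{-1}\tau)$. Put $\mathcal S^D_{nc}(p,q):=\mathcal S_{nc}(X,\gamma)\cap D_n$. Then $$\mathcal S^D_{nc}(p,q)=\{\tau\in D_n : \tau\le\gamma\}.$$ -/

import Mathlib

namespace AnnularD

open Equiv

/-- The number `#(τ)` of orbits of a permutation `τ`: two points are in the same orbit
iff some integer power of `τ` maps one to the other. -/
noncomputable def numOrbits {X : Type*} (τ : Perm X) : ℕ :=
  Nat.card (Quotient (Perm.SameCycle.setoid τ))

/-- The number `#(τ, γ)` of orbits of the subgroup of `Perm X` generated by `τ` and `γ`. -/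
noncomputable def numJointOrbits {X : Type*} (τ γ : Perm X) : ℕ :=
  Nat.card (MulAction.orbitRel.Quotient (Subgroup.closure ({τ, γ} : Set (Perm X))) X)

/-- The set `S_nc(X, γ)` of non-crossing permutations of `X` with respect to `γ`. -/
def Snc (X : Type*) [Fintype X] (γ : Perm X) : Set (Perm X) :=
  {τ | numOrbits τ + numOrbits (τ⁻¹ * γ) + numOrbits γ
      = Fintype.card X + 2 * numJointOrbits τ γ}

/-- The set `{1, …, n} ∪ {-1, …, -n}` of integers. -/
abbrev PM (n : ℕ) : Type := {x : ℤ // x ≠ 0 ∧ -(n : ℤ) ≤ x ∧ x ≤ n}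

noncomputable instance (n : ℕ) : Fintype (PM n) :=
  Fintype.subtype ((Finset.Icc (-(n : ℤ)) n).erase 0) (by simp)

/-- The map `x ↦ -x` on `{±1, …, ±n}`. -/
instance (n : ℕ) : InvolutiveNeg (PM n) where
  neg x := ⟨-x.1, by have := x.2; omega⟩
  neg_neg x := Subtype.ext (neg_neg x.1)

/-- The element `i + 1` of `{±1, …, ±n}`, for `0 ≤ i < n`. -/
def pos {n : ℕ} (i : Fin n) : PM n := ⟨(i : ℤ) + 1, by have := i.2; omega⟩

/-- The cycle `(a₁, …, a_m, -a₁, …, -a_m)`; it is used for distinct `±a₁, …, ±a_m`. -/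
def signedCycle {n m : ℕ} (a : Fin m → PM n) : Perm (PM n) :=
  List.formPerm (List.ofFn a ++ List.ofFn (fun i => -a i))

/-- `γ = (1, …, p, -1, …, -p)(p+1, …, p+q, -(p+1), …, -(p+q))`. -/
def gamma (p q : ℕ) : Perm (PM (p + q)) :=
  signedCycle (fun i : Fin p => pos (Fin.castAdd q i)) *
    signedCycle (fun i : Fin q => pos (Fin.natAdd p i))

/-- The Weyl group `D_n`: the even permutations of `{±1, …, ±n}` that commute
with `x ↦ -x`. -/
def D (n : ℕ) : Subgroup (Perm (PM n)) where
  carrier := {τ | (∀ i, τ (-i) = -τ i) ∧ Perm.sign τ = 1}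
  one_mem' := by simp
  mul_mem' := by
    rintro a b ⟨ha, ha'⟩ ⟨hb, hb'⟩
    exact ⟨fun i => by simp [ha, hb], by simp [ha', hb']⟩
  inv_mem' := by
    rintro a ⟨ha, ha'⟩
    exact ⟨fun i => by rw [Perm.inv_eq_iff_eq, ha]; simp, by simp [ha']⟩

/-- The elements `(i, j)(-i, -j)` and `(i, -j)(-i, j)` of `D_n`, for `1 ≤ i < j ≤ n`. -/
def generators (n : ℕ) : Set (D n) :=
  {g | ∃ i j : PM n, 0 < i.1 ∧ i.1 < j.1 ∧
    ((g : Perm (PM n)) = swap i j * swap (-i) (-j) ∨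
      (g : Perm (PM n)) = swap i (-j) * swap (-i) j)}

/-- The length `ℓ_D(τ)`: the smallest `k` such that `τ` is a product of `k` generators. -/
noncomputable def lengthD {n : ℕ} (τ : D n) : ℕ :=
  sInf {k | ∃ l : List (D n), l.length = k ∧ (∀ g ∈ l, g ∈ generators n) ∧ l.prod = τ}

/-- The order on `D_n`: `σ ≤ τ` iff `ℓ_D(τ) = ℓ_D(σ) + ℓ_D(σ⁻¹ τ)`. -/
def leD {n : ℕ} (σ τ : D n) : Prop :=
  lengthD τ = lengthD σ + lengthD (σ⁻¹ * τ)

/-- `S^D_nc(p, q) = S_nc(X, γ) ∩ D_n`, with `n = p + q` and `X = {±1, …, ±n}`. -/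
def SDnc (p q : ℕ) : Set (Perm (PM (p + q))) :=
  Snc (PM (p + q)) (gamma p q) ∩ (D (p + q) : Set (Perm (PM (p + q))))

theorem signedCycle_aux {n m : ℕ} (a : Fin m → PM n) (ha : Function.Injective a)
    (hpos : ∀ i, 0 < (a i).1) :
    (List.ofFn a ++ List.ofFn (fun i => -a i)).Nodup := by
  rw [List.nodup_append]
  refine ⟨List.nodup_ofFn.2 ha, List.nodup_ofFn.2 fun i j h => ha (neg_injective h), ?_⟩
  intro x hx y hy hxy
  obtain ⟨i, rfl⟩ := (List.mem_ofFn' _ _).1 hx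
  obtain ⟨j, rfl⟩ := (List.mem_ofFn' _ _).1 hy
  have h1 := hpos i
  have h2 := hpos j
  have h3 : (a i).1 = -(a j).1 := congrArg Subtype.val hxy
  omega

theorem formPerm_map_conj {X : Type*} [DecidableEq X] (f : Perm X) :
    ∀ l : List X, List.formPerm (l.map f) = f * List.formPerm l * f⁻¹
  | [] => by simp
  | [x] => by simp
  | x :: y :: l => by
    have h := formPerm_map_conj f (y :: l)
    rw [List.map_cons] at h
    rw [List.map_cons, List.map_cons, List.formPerm_cons_cons, h, List.formPerm_cons_cons,
      swap_apply_apply]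
    group

theorem signedCycle_neg {n m : ℕ} (a : Fin m → PM n) (ha : Function.Injective a)
    (hpos : ∀ i, 0 < (a i).1) (x : PM n) :
    signedCycle a (-x) = -signedCycle a x := by
  have hnd := signedCycle_aux a ha hpos
  have h1 : (List.ofFn a ++ List.ofFn (fun i => -a i)).map (Equiv.neg (PM n))
      = (List.ofFn a ++ List.ofFn (fun i => -a i)).rotate m := by
    have := List.rotate_append_length_eq (List.ofFn a) (List.ofFn (fun i => -a i))
    rw [List.length_ofFn] at this
    rw [this]
    simp [List.map_ofFn, Function.comp_def]
  have h2 := formPerm_map_conj (Equiv.neg (PM n))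
    (List.ofFn a ++ List.ofFn (fun i => -a i))
  rw [h1, List.formPerm_rotate _ hnd, eq_mul_inv_iff_mul_eq] at h2
  have h3 := congrArg (fun f : Perm (PM n) => f x) h2
  simpa [signedCycle] using h3

theorem sign_signedCycle {n m : ℕ} (hm : 0 < m) (a : Fin m → PM n)
    (ha : Function.Injective a) (hpos : ∀ i, 0 < (a i).1) :
    Perm.sign (signedCycle a) = -1 := by
  have hnd := signedCycle_aux a ha hpos
  have hc := List.isCycle_formPerm hnd (by simp; omega)
  have hs := List.support_formPerm_of_nodup _ hnd (by
    intro x hx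
    have := congrArg List.length hx
    simp at this
    omega)
  unfold signedCycle
  rw [hc.sign, hs, List.toFinset_card_of_nodup hnd]
  simp [← two_mul]

theorem gamma_mem_D {p q : ℕ} (hp : 0 < p) (hq : 0 < q) : gamma p q ∈ D (p + q) := by
  have hP : Function.Injective (fun i : Fin p => (pos (Fin.castAdd q i) : PM (p + q))) := by
    intro i j h
    have := congrArg Subtype.val h
    simp only [pos, Fin.val_castAdd] at this
    exact Fin.ext (by omega)
  have hQ : Function.Injective (fun i : Fin q => (pos (Fin.natAdd p i) : PM (p + q))) := by
    intro i j h
    have := congrArg Subtype.val h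
    simp only [pos, Fin.val_natAdd] at this
    exact Fin.ext (by omega)
  have hpos : ∀ i : Fin (p + q), 0 < (pos i).1 := fun i => by simp only [pos]; omega
  refine ⟨fun i => ?_, ?_⟩
  · simp only [gamma, Perm.mul_apply]
    rw [signedCycle_neg _ hQ fun _ => hpos _, signedCycle_neg _ hP fun _ => hpos _]
  · rw [gamma, map_mul, sign_signedCycle hp _ hP fun _ => hpos _,
      sign_signedCycle hq _ hQ fun _ => hpos _]
    simp

/-- `γ` as an element of `D_{p+q}`. -/
def gammaD (p q : ℕ) (hp : 0 < p) (hq : 0 < q) : D (p + q) :=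
  ⟨gamma p q, gamma_mem_D hp hq⟩

end AnnularD

namespace AnnularD

open Equiv Module

/-! Orbit counts are dimensions of spaces of invariant real functions, and for a signed permutation
such a space splits into an even and an odd part. All even functions and all odd functions have the
same dimension N. Put κ = τ⁻¹γ.

The odd part computes length: `lengthD_add_oddDim` gives ℓ_D(σ) = N - `oddDim σ`. Since γ has no
nonzero odd invariants, τ ≤ γ means `oddDim τ + oddDim κ = N`.

The genus inequality `finrank_inv_add_le` holds on each part: `oddDim τ + oddDim κ ≤ N` and `evenDim
τ + evenDim κ + 2 ≤ N + 2k`, with k the number of joint orbits of τ and γ. The sum of the two is the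
usual genus inequality, so τ is non-crossing exactly when both are equalities.

It remains to see that the odd equality forces the even one. If k = 1, this follows from `oddDim ≤
evenDim`. If k = 2, two more even dimensions are needed. The difference `evenDim - oddDim` counts
the balanced cycles, those with c = -c. A signed permutation without balanced cycles is even, while
each of the two cycles of γ is an odd permutation; so each contains a balanced cycle of τ or of κ
(`inv_gamma_inf_vanishing`, `le_evenDim_add_evenDim`). -/

/-- The functions that are invariant under a permutation. -/
def inv {X : Type*} (σ : Perm X) : Submodule ℝ (X → ℝ) where
  carrier := {f | ∀ x, f (σ x) = f x}
  zero_mem' _ := rfl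
  add_mem' hf hg x := by simp only [Pi.add_apply, hf x, hg x]
  smul_mem' c f hf x := by simp only [Pi.smul_apply, hf x]

/-! ### Orbit counts as dimensions, and the genus inequality -/

section invariants

variable {X : Type*}

theorem mem_inv {σ : Perm X} {f : X → ℝ} : f ∈ inv σ ↔ ∀ x, f (σ x) = f x := Iff.rfl

theorem apply_inv_of_mem_inv {σ : Perm X} {f : X → ℝ} (hf : f ∈ inv σ) (x : X) :
    f (σ⁻¹ x) = f x := by
  simpa using (hf (σ⁻¹ x)).symm

theorem inv_one : inv (1 : Perm X) = ⊤ := eq_top_iff.2 fun _ _ _ => rfl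

theorem inv_inf_inv_mul (σ τ : Perm X) : inv σ ⊓ inv (σ * τ) = inv σ ⊓ inv τ := by
  ext f
  simp only [Submodule.mem_inf, mem_inv, Perm.mul_apply]
  exact and_congr_right fun h => forall_congr' fun x => by rw [h]

theorem mem_inv_of_mem_closure {S : Set (Perm X)} {f : X → ℝ} (hf : ∀ g ∈ S, f ∈ inv g)
    {g : Perm X} (hg : g ∈ Subgroup.closure S) : f ∈ inv g := by
  induction hg using Subgroup.closure_induction with
  | mem g hg => exact hf g hg
  | one => exact fun _ => rfl
  | mul a b _ _ ha hb => exact fun x => by rw [Perm.mul_apply, ha, hb]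
  | inv a _ ha => exact apply_inv_of_mem_inv ha

theorem apply_eq_of_sameCycle {σ : Perm X} {f : X → ℝ} (hf : f ∈ inv σ) {x y : X}
    (h : σ.SameCycle x y) : f x = f y := by
  obtain ⟨k, hk⟩ := h
  have hmem : σ ^ k ∈ Subgroup.closure {σ} :=
    Subgroup.zpow_mem _ (Subgroup.subset_closure (Set.mem_singleton σ)) k
  have hinv : f ∈ inv (σ ^ k) :=
    mem_inv_of_mem_closure (fun g hg => (Set.mem_singleton_iff.1 hg).symm ▸ hf) hmem
  rw [← hk, hinv x]

/-- Functions that are constant on the classes of `s` are functions on the quotient. -/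
theorem finrank_eq_card_quotient [Finite X] (s : Setoid X) (U : Submodule ℝ (X → ℝ))
    (hU : ∀ f, f ∈ U ↔ ∀ x y, s x y → f x = f y) :
    finrank ℝ U = Nat.card (Quotient s) := by
  have := Fintype.ofFinite (Quotient s)
  let φ : (Quotient s → ℝ) →ₗ[ℝ] (X → ℝ) := LinearMap.funLeft ℝ ℝ (Quotient.mk s)
  have hφ : Function.Injective φ :=
    LinearMap.funLeft_injective_of_surjective ℝ ℝ _ Quotient.mk_surjective
  have hr : LinearMap.range φ = U := by
    ext f
    rw [hU]
    constructor
    · rintro ⟨g, rfl⟩ x y h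
      exact congrArg g (Quotient.sound h)
    · exact fun h => ⟨Quotient.lift f h, rfl⟩
  rw [← hr, LinearMap.finrank_range_of_inj hφ, finrank_fintype_fun_eq_card,
    Nat.card_eq_fintype_card]

theorem finrank_inv [Finite X] (σ : Perm X) : finrank ℝ (inv σ) = numOrbits σ :=
  finrank_eq_card_quotient _ _ fun f =>
    ⟨fun hf _ _ h => apply_eq_of_sameCycle hf h, fun h x => (h _ _ ⟨1, by simp⟩).symm⟩

theorem finrank_inv_inf_inv [Finite X] (σ τ : Perm X) :
    finrank ℝ (inv σ ⊓ inv τ : Submodule ℝ (X → ℝ)) = numJointOrbits σ τ := by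
  refine finrank_eq_card_quotient _ _ fun f => ⟨fun hf x y h => ?_, fun h => ⟨fun x => ?_, fun x => ?_⟩⟩
  · obtain ⟨⟨g, hg⟩, hx⟩ := h
    rw [← hx]
    refine mem_inv_of_mem_closure ?_ hg y
    rintro g (rfl | rfl)
    exacts [hf.1, hf.2]
  · exact h _ _ ⟨⟨σ, Subgroup.subset_closure (by simp)⟩, rfl⟩
  · exact h _ _ ⟨⟨τ, Subgroup.subset_closure (by simp)⟩, rfl⟩

/-- The genus inequality, for the invariant functions in a subspace. -/
theorem finrank_inv_add_le [Fintype X] (σ τ : Perm X) (W : Submodule ℝ (X → ℝ))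
    (hW : ∀ f ∈ W, (fun x => f (τ⁻¹ x)) ∈ W) :
    finrank ℝ (W ⊓ inv σ : Submodule ℝ (X → ℝ)) + finrank ℝ (W ⊓ inv τ : Submodule ℝ (X → ℝ)) +
      finrank ℝ (W ⊓ inv (σ * τ) : Submodule ℝ (X → ℝ)) ≤
    finrank ℝ W + 2 * finrank ℝ (W ⊓ (inv σ ⊓ inv τ) : Submodule ℝ (X → ℝ)) := by
  set A := W ⊓ inv σ
  set B := W ⊓ inv τ
  set C := W ⊓ inv (σ * τ)
  let M : (X → ℝ) →ₗ[ℝ] (X → ℝ) := LinearMap.funLeft ℝ ℝ (τ⁻¹ : Perm X) - LinearMap.id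
  have hM : ∀ f x, M f x = f (τ⁻¹ x) - f x := fun f x => rfl
  have hAB : A ⊓ B = W ⊓ (inv σ ⊓ inv τ) := (inf_inf_distrib_left _ _ _).symm
  have h1 := Submodule.finrank_sup_add_finrank_inf_eq A B
  have h2 := (M.domRestrict C).finrank_range_add_finrank_ker
  -- The kernel of `M` on `C` consists of functions invariant under both `τ` and `σ * τ`, hence
  -- under `σ`.
  have h3 : finrank ℝ (LinearMap.ker (M.domRestrict C)) ≤ finrank ℝ (A ⊓ B : Submodule ℝ (X → ℝ)) := by
    refine LinearMap.finrank_le_finrank_of_injective (f :=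
      (C.subtype.comp (LinearMap.ker (M.domRestrict C)).subtype).codRestrict (A ⊓ B) ?_) ?_
    · rintro ⟨⟨f, hf⟩, hf'⟩
      have hτ : f ∈ inv τ := fun x => by
        have := congrFun (LinearMap.mem_ker.1 hf') (τ x)
        rw [LinearMap.domRestrict_apply, hM, Perm.inv_def, symm_apply_apply] at this
        exact (sub_eq_zero.1 this).symm
      have hσ : f ∈ inv σ := fun x => by
        have := hf.2 (τ⁻¹ x)
        rw [apply_inv_of_mem_inv hτ] at this
        simpa using this
      exact ⟨⟨hf.1, hσ⟩, hf.1, hτ⟩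
    · intro f g h
      have h' := congrArg Subtype.val h
      exact Subtype.ext (Subtype.ext h')
  set R := LinearMap.range (M.domRestrict C)
  have hRW : R ≤ W := by
    rintro _ ⟨⟨f, hf⟩, rfl⟩
    exact W.sub_mem (hW f hf.1) hf.1
  -- The range of `M` on `C` is orthogonal to `A` and `B`: move `τ⁻¹` to the other factor, then use
  -- `τ`-invariance on `B`, or reindex by `σ * τ` on `A`. So `R` and `A ⊔ B` fit independently
  -- inside `W`, which bounds the dimensions.
  have horth : ∀ l ∈ C, ∀ f ∈ A ⊔ B, ∑ x, M l x * f x = 0 := by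
    intro l hl f hf
    have hshift : ∀ g : X → ℝ, ∑ x, M l x * g x = ∑ x, l x * g (τ x) - ∑ x, l x * g x := by
      intro g
      simp only [hM, sub_mul, Finset.sum_sub_distrib]
      congr 1
      rw [← Equiv.sum_comp τ]
      simp
    obtain ⟨a, ha, b, hb, rfl⟩ := Submodule.mem_sup.1 hf
    have ha0 : ∑ x, M l x * a x = 0 := by
      rw [hshift, sub_eq_zero, ← Equiv.sum_comp (σ * τ) (fun x => l x * a x)]
      refine Finset.sum_congr rfl fun x _ => ?_
      rw [hl.2 x, Perm.mul_apply, ha.2]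
    have hb0 : ∑ x, M l x * b x = 0 := by
      rw [hshift, sub_eq_zero]
      exact Finset.sum_congr rfl fun x _ => by rw [hb.2]
    simp only [Pi.add_apply, mul_add, Finset.sum_add_distrib, ha0, hb0, add_zero]
  have hdisj : R ⊓ (A ⊔ B) = ⊥ := by
    rw [eq_bot_iff]
    rintro _ ⟨⟨⟨l, hl⟩, rfl⟩, hf⟩
    have h0 := horth l hl _ hf
    rw [Submodule.mem_bot]
    ext x
    exact mul_self_eq_zero.1
      ((Finset.sum_eq_zero_iff_of_nonneg fun x _ => mul_self_nonneg _).1 h0 x (Finset.mem_univ x))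
  have h4 := Submodule.finrank_sup_add_finrank_inf_eq R (A ⊔ B)
  rw [hdisj, finrank_bot] at h4
  have h5 : finrank ℝ (R ⊔ (A ⊔ B) : Submodule ℝ (X → ℝ)) ≤ finrank ℝ W :=
    Submodule.finrank_mono (sup_le hRW (sup_le inf_le_left inf_le_left))
  rw [← hAB]
  omega

end invariants

/-! ### Even and odd functions -/

/-- The even functions on `{±1, …, ±n}`. -/
def evenFun (n : ℕ) : Submodule ℝ (PM n → ℝ) where
  carrier := {f | ∀ x, f (-x) = f x}
  zero_mem' _ := rfl
  add_mem' hf hg x := by simp only [Pi.add_apply, hf x, hg x]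
  smul_mem' c f hf x := by simp only [Pi.smul_apply, hf x]

/-- The odd functions on `{±1, …, ±n}`. -/
def oddFun (n : ℕ) : Submodule ℝ (PM n → ℝ) where
  carrier := {f | ∀ x, f (-x) = -f x}
  zero_mem' _ := by simp
  add_mem' hf hg x := by simp only [Pi.add_apply, hf x, hg x, neg_add]
  smul_mem' c f hf x := by simp only [Pi.smul_apply, hf x, smul_neg]

variable {n : ℕ}

theorem finrank_eq_even_add_odd (U : Submodule ℝ (PM n → ℝ))
    (hU : ∀ f ∈ U, (fun x => f (-x)) ∈ U) :
    finrank ℝ U = finrank ℝ (evenFun n ⊓ U : Submodule ℝ (PM n → ℝ)) +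
      finrank ℝ (oddFun n ⊓ U : Submodule ℝ (PM n → ℝ)) := by
  have h := Submodule.finrank_sup_add_finrank_inf_eq (evenFun n ⊓ U) (oddFun n ⊓ U)
  have h1 : (evenFun n ⊓ U) ⊓ (oddFun n ⊓ U) = ⊥ := by
    rw [eq_bot_iff]
    rintro f ⟨hf, hg⟩
    ext x
    have h1 := hf.1 x
    have h2 := hg.1 x
    change f x = 0
    linarith
  have h2 : (evenFun n ⊓ U) ⊔ (oddFun n ⊓ U) = U := by
    refine le_antisymm (sup_le inf_le_right inf_le_right) fun f hf => ?_
    refine Submodule.mem_sup.2 ⟨(1 / 2 : ℝ) • (f + fun x => f (-x)),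
      ⟨fun x => ?_, U.smul_mem _ (U.add_mem hf (hU f hf))⟩,
      (1 / 2 : ℝ) • (f - fun x => f (-x)),
      ⟨fun x => ?_, U.smul_mem _ (U.sub_mem hf (hU f hf))⟩, ?_⟩
    · simp only [Pi.smul_apply, Pi.add_apply, neg_neg, smul_eq_mul]; ring
    · simp only [Pi.smul_apply, Pi.sub_apply, neg_neg, smul_eq_mul]; ring
    · ext x
      simp only [Pi.smul_apply, Pi.add_apply, Pi.sub_apply, smul_eq_mul]; ring
  rw [h1, h2, finrank_bot, add_zero] at h
  exact h

theorem inv_comp_neg {τ : Perm (PM n)} (hτ : ∀ i, τ (-i) = -τ i) (f : PM n → ℝ) (hf : f ∈ inv τ) :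
    (fun x => f (-x)) ∈ inv τ := fun x => by
  change f (-τ x) = f (-x)
  rw [← hτ, hf]

theorem commute_neg_inv {τ : Perm (PM n)} (hτ : ∀ i, τ (-i) = -τ i) (i : PM n) :
    τ⁻¹ (-i) = -τ⁻¹ i := by
  rw [Perm.inv_eq_iff_eq, hτ]; simp

theorem neg_ne_self (x : PM n) : -x ≠ x := fun h => by
  have := congrArg Subtype.val h
  have h2 : (-x).1 = -x.1 := rfl
  have := x.2.1
  omega

/-! ### The reflections of `D n` -/

/-- The permutation `(x, y)(-x, -y)`. -/
def doubleSwap (x y : PM n) : Perm (PM n) := swap x y * swap (-x) (-y)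

section doubleSwap

variable {x y : PM n}

theorem doubleSwap_apply_of_ne {z : PM n} (h1 : z ≠ x) (h2 : z ≠ y) (h3 : z ≠ -x) (h4 : z ≠ -y) :
    doubleSwap x y z = z := by
  rw [doubleSwap, Perm.mul_apply, swap_apply_of_ne_of_ne h3 h4, swap_apply_of_ne_of_ne h1 h2]

theorem swap_mul_swap_neg_comm (h1 : x ≠ y) (h2 : x ≠ -y) :
    swap x y * swap (-x) (-y) = swap (-x) (-y) * swap x y := by
  have hx := neg_ne_self x
  have hy := neg_ne_self y
  have h3 : y ≠ -x := fun h => h2 (by rw [h, neg_neg])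
  refine (Perm.disjoint_swap_swap ?_).commute.eq
  simp [h1, h2, h3, hx.symm, hy.symm]

theorem doubleSwap_apply_left (h2 : x ≠ -y) : doubleSwap x y x = y := by
  rw [doubleSwap, Perm.mul_apply, swap_apply_of_ne_of_ne (neg_ne_self x).symm h2, swap_apply_left]

theorem doubleSwap_comm : doubleSwap x y = doubleSwap y x := by
  rw [doubleSwap, doubleSwap, swap_comm x, swap_comm (-x)]

theorem doubleSwap_neg (h1 : x ≠ y) (h2 : x ≠ -y) : doubleSwap (-x) (-y) = doubleSwap x y := by
  rw [doubleSwap, doubleSwap, neg_neg, neg_neg, swap_mul_swap_neg_comm h1 h2]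

theorem doubleSwap_apply_neg (h1 : x ≠ y) (h2 : x ≠ -y) (z : PM n) :
    doubleSwap x y (-z) = -doubleSwap x y z := by
  have hconj : ∀ a b : PM n, swap (-a) (-b) = Equiv.neg _ * swap a b * (Equiv.neg _)⁻¹ :=
    fun a b => swap_apply_apply (Equiv.neg (PM n)) a b
  have h : doubleSwap (-x) (-y) = Equiv.neg _ * doubleSwap x y * (Equiv.neg _)⁻¹ := by
    rw [doubleSwap, doubleSwap, hconj (-x), hconj x]
    group
  rw [doubleSwap_neg h1 h2, eq_mul_inv_iff_mul_eq] at h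
  exact congrArg (fun f : Perm (PM n) => f z) h

theorem doubleSwap_mem_D (h1 : x ≠ y) (h2 : x ≠ -y) : doubleSwap x y ∈ D n := by
  refine ⟨doubleSwap_apply_neg h1 h2, ?_⟩
  rw [doubleSwap, map_mul, Perm.sign_swap h1, Perm.sign_swap fun h => h1 (neg_injective h)]
  simp

theorem doubleSwap_mul_self (h1 : x ≠ y) (h2 : x ≠ -y) :
    doubleSwap x y * doubleSwap x y = 1 := by
  conv_lhs => rw [doubleSwap]; rhs; rw [swap_mul_swap_neg_comm h1 h2]
  rw [mul_assoc, ← mul_assoc (swap (-x) (-y)), swap_mul_self, one_mul, swap_mul_self]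

theorem neg_val (x : PM n) : (-x).1 = -x.1 := rfl

/-- Removes the order and sign conditions: exchanging `x` and `y`, or negating both, leaves
`doubleSwap x y` unchanged, so one may take 0 < x ≤ |y|, and the sign of `y` then selects the
family. -/
theorem mem_generators {g : D n} :
    g ∈ generators n ↔ ∃ x y : PM n, x ≠ y ∧ x ≠ -y ∧ (g : Perm (PM n)) = doubleSwap x y := by
  constructor
  · rintro ⟨i, j, hi, hij, h | h⟩
    · refine ⟨i, j, fun e => ?_, fun e => ?_, h⟩ <;> have := congrArg Subtype.val e
      · omega
      · rw [neg_val] at this; omega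
    · refine ⟨i, -j, fun e => ?_, fun e => ?_, by rw [h, doubleSwap, neg_neg]⟩ <;>
        have := congrArg Subtype.val e
      · rw [neg_val] at this; omega
      · rw [neg_neg] at this; omega
  · rintro ⟨x, y, h1, h2, h⟩
    wlog hxy : |x.1| ≤ |y.1| generalizing x y
    · exact this y x h1.symm (fun e => h2 (by rw [e, neg_neg])) (by rw [h, doubleSwap_comm])
        (le_of_not_ge hxy)
    wlog hx : 0 < x.1 generalizing x y
    · refine this (-x) (-y) (fun e => h1 (neg_injective e)) (fun e => h2 (neg_injective e))
        (by rw [h, doubleSwap_neg h1 h2]) (by simpa [neg_val] using hxy) ?_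
      have := x.2.1
      rw [neg_val]; omega
    have h1' : x.1 ≠ y.1 := fun e => h1 (Subtype.ext e)
    have h2' : x.1 ≠ -y.1 := fun e => h2 (Subtype.ext e)
    rw [abs_of_pos hx] at hxy
    rcases lt_or_gt_of_ne y.2.1 with hy | hy
    · rw [abs_of_neg hy] at hxy
      exact ⟨x, -y, hx, by rw [neg_val]; omega, Or.inr (by rw [h, neg_neg]; rfl)⟩
    · rw [abs_of_pos hy] at hxy
      exact ⟨x, y, hx, by omega, Or.inl h⟩

theorem apply_doubleSwap {f : PM n → ℝ} (hf : f ∈ oddFun n) (h : f x = f y) (z : PM n) :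
    f (doubleSwap x y z) = f z := by
  have hswap : ∀ {a b : PM n}, f a = f b → ∀ z, f (swap a b z) = f z := by
    intro a b hab z
    rw [swap_apply_def]
    split_ifs with h1 h2
    · rw [h1, hab]
    · rw [h2, hab]
    · rfl
  rw [doubleSwap, Perm.mul_apply, hswap h, hswap (by rw [hf x, hf y, h])]

end doubleSwap

/-! ### Reflection length and odd invariants -/

/-- The dimension of the space of invariant odd functions: the number of pairs `{c, -c}` of
distinct cycles. -/
noncomputable def oddDim (σ : Perm (PM n)) : ℕ :=
  finrank ℝ (oddFun n ⊓ inv σ : Submodule ℝ (PM n → ℝ))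

theorem oddDim_le (σ : Perm (PM n)) : oddDim σ ≤ finrank ℝ (oddFun n) :=
  Submodule.finrank_mono inf_le_left

theorem oddDim_one : oddDim (1 : Perm (PM n)) = finrank ℝ (oddFun n) := by
  rw [oddDim, inv_one, inf_top_eq]

/-- The single linear condition `f x = f y` cuts out odd invariants of `σ` that survive
multiplication by the reflection, and it costs at most one dimension. -/
theorem oddDim_le_doubleSwap_mul {x y : PM n} (σ : Perm (PM n)) :
    oddDim σ ≤ oddDim (doubleSwap x y * σ) + 1 := by
  set U : Submodule ℝ (PM n → ℝ) := oddFun n ⊓ inv σ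
  let φ : U →ₗ[ℝ] ℝ :=
    (LinearMap.proj (R := ℝ) (φ := fun _ : PM n => ℝ) x -
      LinearMap.proj (R := ℝ) (φ := fun _ : PM n => ℝ) y).domRestrict U
  have h1 := φ.finrank_range_add_finrank_ker
  have h2 : finrank ℝ (LinearMap.range φ) ≤ 1 :=
    (Submodule.finrank_le _).trans (finrank_self ℝ).le
  have h3 : finrank ℝ (LinearMap.ker φ) ≤ oddDim (doubleSwap x y * σ) := by
    rw [← Submodule.finrank_map_subtype_eq]
    refine Submodule.finrank_mono ?_
    rintro _ ⟨⟨f, hf⟩, hk, rfl⟩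
    refine ⟨hf.1, fun z => ?_⟩
    have hxy : f x = f y := sub_eq_zero.1 (LinearMap.mem_ker.1 hk)
    change f (doubleSwap x y (σ z)) = f z
    rw [apply_doubleSwap hf.1 hxy, hf.2]
  change finrank ℝ U ≤ _
  omega

theorem finrank_odd_le_oddDim_add_length (l : List (D n)) (hl : ∀ g ∈ l, g ∈ generators n) :
    finrank ℝ (oddFun n) ≤ oddDim (l.prod : Perm (PM n)) + l.length := by
  induction l with
  | nil => simp [oddDim_one]
  | cons g l ih =>
    have h := ih fun g' hg' => hl g' (List.mem_cons_of_mem _ hg')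
    obtain ⟨x, y, -, -, hg⟩ := mem_generators.1 (hl g List.mem_cons_self)
    rw [List.prod_cons, Subgroup.coe_mul, hg, List.length_cons]
    have := oddDim_le_doubleSwap_mul (x := x) (y := y) (l.prod : Perm (PM n))
    omega

/-- The odd function supported on `±x` with value `1` at `x`. -/
noncomputable def oddSingle (x : PM n) : PM n → ℝ := Pi.single x 1 - Pi.single (-x) 1

theorem oddSingle_mem (x : PM n) : oddSingle x ∈ oddFun n := by
  intro z
  simp only [oddSingle, Pi.sub_apply, Pi.single_apply, neg_eq_iff_eq_neg, neg_neg]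
  ring

theorem oddSingle_self (x : PM n) : oddSingle x x = 1 := by
  simp [oddSingle, (neg_ne_self x).symm]

theorem oddSingle_of_ne {x z : PM n} (h1 : z ≠ x) (h2 : z ≠ -x) : oddSingle x z = 0 := by
  simp [oddSingle, h1, h2]

/-- By `hσ` no odd invariant of `σ` is lost, and `f` is a new one. -/
theorem oddDim_lt_doubleSwap_mul {x y : PM n} {σ : Perm (PM n)}
    (hσ : ∀ f ∈ oddFun n, f ∈ inv σ → f x = f y) {f : PM n → ℝ} (hf : f ∈ oddFun n)
    (hf1 : f ∈ inv (doubleSwap x y * σ)) (hf2 : f ∉ inv σ) :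
    oddDim σ < oddDim (doubleSwap x y * σ) := by
  refine Submodule.finrank_lt_finrank_of_lt (lt_of_le_of_ne ?_ ?_)
  · rintro g ⟨hg, hg'⟩
    refine ⟨hg, fun z => ?_⟩
    rw [Perm.mul_apply, apply_doubleSwap hg (hσ g hg hg'), hg']
  · intro h
    exact hf2 (h.ge ⟨hf, hf1⟩ : f ∈ oddFun n ⊓ inv σ).2

/-- An even signed permutation other than `1` can be shortened by a generator. -/
theorem exists_oddDim_lt {σ : Perm (PM n)} (hσ : σ ∈ D n) (h1 : σ ≠ 1) :
    ∃ x y : PM n, x ≠ y ∧ x ≠ -y ∧ oddDim σ < oddDim (doubleSwap x y * σ) := by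
  by_cases hc : ∃ x, σ x ≠ x ∧ σ x ≠ -x
  · obtain ⟨x, hx, hx'⟩ := hc
    have hx2 : x ≠ -σ x := fun h => hx' (by rw [← neg_eq_iff_eq_neg] at h; exact h.symm)
    -- The product with this reflection fixes `x` and `-x`, which `σ` does not, so `oddSingle x`
    -- becomes invariant.
    refine ⟨x, σ x, hx.symm, hx2, oddDim_lt_doubleSwap_mul (fun f _ hf => (hf x).symm)
      (oddSingle_mem x) ?_ ?_⟩
    · have hfix : doubleSwap x (σ x) (σ x) = x := by
        rw [doubleSwap_comm, doubleSwap_apply_left hx']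
      have hfix' : doubleSwap x (σ x) (σ (-x)) = -x := by
        rw [hσ.1, doubleSwap_apply_neg hx.symm hx2, hfix]
      intro z
      by_cases hz : z = x
      · rw [hz, Perm.mul_apply, hfix]
      by_cases hz' : z = -x
      · rw [hz', Perm.mul_apply, hfix']
      rw [oddSingle_of_ne hz hz', oddSingle_of_ne]
      · exact fun h => hz ((doubleSwap x (σ x) * σ).injective (h.trans hfix.symm))
      · exact fun h => hz' ((doubleSwap x (σ x) * σ).injective (h.trans hfix'.symm))
    · intro h
      have := h x
      rw [oddSingle_self, oddSingle_of_ne hx hx'] at this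
      exact zero_ne_one this
  · push Not at hc
    have hc' : ∀ x, σ x = x ∨ σ x = -x := fun x => by
      by_cases h : σ x = x
      exacts [Or.inl h, Or.inr (hc x h)]
    obtain ⟨x, hx⟩ : ∃ x, σ x ≠ x := by
      by_contra! h
      exact h1 (Perm.ext h)
    have hx := hc x hx
    -- Here `σ` only changes signs. With one sign change it would be a transposition, hence odd;
    -- evenness supplies a second.
    obtain ⟨y, hy, hyx, hyx'⟩ : ∃ y, σ y = -y ∧ y ≠ x ∧ y ≠ -x := by
      by_contra! h
      have : σ = swap x (-x) := by
        ext1 z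
        by_cases hz : z = x
        · rw [hz, swap_apply_left, hx]
        by_cases hz' : z = -x
        · rw [hz', swap_apply_right, hσ.1, hx, neg_neg]
        rw [swap_apply_of_ne_of_ne hz hz']
        exact (hc' z).resolve_right fun hzz => hz' (h z hzz hz)
      have hs := hσ.2
      rw [this, Perm.sign_swap (neg_ne_self x).symm] at hs
      exact absurd hs (by decide)
    have hx2 : x ≠ -y := fun h => hyx' (by rw [h, neg_neg])
    have hval : ∀ {z f}, σ z = -z → f ∈ oddFun n → f ∈ inv σ → f z = 0 := by
      intro z f hz hf hf'
      have h1 := hf z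
      have h2 := hf' z
      rw [hz] at h2
      linarith
    -- Odd invariants of `σ` vanish at `x` and `y`. The product sends `x` to `-y` and `y` to `-x`,
    -- so it gains an odd invariant with values 1 at `x` and -1 at `y`.
    refine ⟨x, y, hyx.symm, hx2, oddDim_lt_doubleSwap_mul
      (fun f hf hf' => by rw [hval hx hf hf', hval hy hf hf'])
      ((oddFun n).sub_mem (oddSingle_mem x) (oddSingle_mem y)) ?_ ?_⟩
    · set f := oddSingle x - oddSingle y with hfdef
      have hf : f ∈ oddFun n := (oddFun n).sub_mem (oddSingle_mem x) (oddSingle_mem y)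
      have hyx2 : y ≠ -x := hyx'
      have fx : f x = 1 := by
        rw [hfdef, Pi.sub_apply, oddSingle_self, oddSingle_of_ne hyx.symm hx2, sub_zero]
      have fy : f y = -1 := by
        rw [hfdef, Pi.sub_apply, oddSingle_self, oddSingle_of_ne hyx hyx2, zero_sub]
      have gx : f ((doubleSwap x y * σ) x) = f x := by
        rw [Perm.mul_apply, hx, doubleSwap_apply_neg hyx.symm hx2, doubleSwap_apply_left hx2, hf, fx,
          fy, neg_neg]
      have gy : f ((doubleSwap x y * σ) y) = f y := by
        rw [Perm.mul_apply, hy, doubleSwap_apply_neg hyx.symm hx2, doubleSwap_comm,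
          doubleSwap_apply_left hyx2, hf, fx, fy]
      have hneg : ∀ z, f ((doubleSwap x y * σ) z) = f z →
          f ((doubleSwap x y * σ) (-z)) = f (-z) := by
        intro z hz
        rw [Perm.mul_apply, hσ.1, doubleSwap_apply_neg hyx.symm hx2, hf, hf, ← Perm.mul_apply, hz]
      intro z
      by_cases h1 : z = x
      · rw [h1, gx]
      by_cases h2 : z = y
      · rw [h2, gy]
      by_cases h3 : z = -x
      · rw [h3, hneg x gx]
      by_cases h4 : z = -y
      · rw [h4, hneg y gy]
      rcases hc' z with hz | hz
      · rw [Perm.mul_apply, hz, doubleSwap_apply_of_ne h1 h2 h3 h4]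
      · have hz0 : f z = 0 := by
          rw [hfdef, Pi.sub_apply, oddSingle_of_ne h1 h3, oddSingle_of_ne h2 h4, sub_zero]
        rw [Perm.mul_apply, hz, doubleSwap_apply_neg hyx.symm hx2,
          doubleSwap_apply_of_ne h1 h2 h3 h4, hf, hz0, neg_zero]
    · intro h
      have h1 := hval hx ((oddFun n).sub_mem (oddSingle_mem x) (oddSingle_mem y)) h
      rw [Pi.sub_apply, oddSingle_self, oddSingle_of_ne hyx.symm hx2, sub_zero] at h1
      exact one_ne_zero h1

theorem exists_list_generators (σ : D n) :
    ∃ l : List (D n), l.length + oddDim (σ : Perm (PM n)) ≤ finrank ℝ (oddFun n) ∧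
      (∀ g ∈ l, g ∈ generators n) ∧ l.prod = σ := by
  induction hk : finrank ℝ (oddFun n) - oddDim (σ : Perm (PM n)) using Nat.strong_induction_on
    generalizing σ with
  | _ k ih =>
    by_cases h1 : σ = 1
    · exact ⟨[], by simpa [h1] using oddDim_le _, by simp, by simp [h1]⟩
    · obtain ⟨x, y, hxy, hxy', hlt⟩ := exists_oddDim_lt σ.2 fun h => h1 (Subtype.ext h)
      let g : D n := ⟨doubleSwap x y, doubleSwap_mem_D hxy hxy'⟩
      have hg : g * g = 1 := Subtype.ext (doubleSwap_mul_self hxy hxy')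
      have hlt' : oddDim (σ : Perm (PM n)) < oddDim ((g * σ : D n) : Perm (PM n)) := hlt
      have hle := oddDim_le ((g * σ : D n) : Perm (PM n))
      obtain ⟨l, hl1, hl2, hl3⟩ := ih _ (by omega) (g * σ) rfl
      refine ⟨g :: l, by rw [List.length_cons]; omega, ?_, ?_⟩
      · rintro g' hg'
        rcases List.mem_cons.1 hg' with rfl | hg'
        · exact mem_generators.2 ⟨x, y, hxy, hxy', rfl⟩
        · exact hl2 g' hg'
      · rw [List.prod_cons, hl3, ← mul_assoc, hg, one_mul]

/-- Carter's formula for the reflection length in `D_n`. -/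
theorem lengthD_add_oddDim (σ : D n) :
    lengthD σ + oddDim (σ : Perm (PM n)) = finrank ℝ (oddFun n) := by
  obtain ⟨l, hl1, hl2, hl3⟩ := exists_list_generators σ
  refine le_antisymm ?_ ?_
  · have : lengthD σ ≤ l.length := Nat.sInf_le ⟨l, rfl, hl2, hl3⟩
    omega
  -- The list `l` shows that the set is nonempty, so the infimum is attained and is not the default
  -- 0.
  · obtain ⟨l', hl1', hl2', hl3'⟩ := Nat.sInf_mem
      (s := {k | ∃ l : List (D n), l.length = k ∧ (∀ g ∈ l, g ∈ generators n) ∧ l.prod = σ})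
      ⟨_, l, rfl, hl2, hl3⟩
    have := finrank_odd_le_oddDim_add_length l' hl2'
    rw [hl3', hl1'] at this
    rw [lengthD]
    omega

/-! ### Balanced cycles: even against odd invariants, and parity -/

section balanced

/-- An odd invariant function that vanishes only on the cycles `c` with `c = -c`. -/
theorem exists_odd_invariant (σ : Perm (PM n)) (hσ : ∀ i, σ (-i) = -σ i) :
    ∃ a ∈ oddFun n, a ∈ inv σ ∧ ∀ x, a x = 0 → σ.SameCycle x (-x) := by
  classical
  let S : PM n → Finset (PM n) := fun x => Finset.univ.filter fun y => σ.SameCycle x y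
  -- `v` is injective because `y.1 + n ≥ 0`. Hence the cycle maximum `M` separates cycles, and `M x
  -- - M (-x)` vanishes only if `x` and `-x` share a cycle.
  let v : PM n → ℕ := fun y => (y.1 + n).toNat
  let M : PM n → ℕ := fun x => (S x).sup v
  have hM : ∀ x, M (σ x) = M x := by
    intro x
    have : S (σ x) = S x := by
      ext y
      simp only [S, Finset.mem_filter, Finset.mem_univ, true_and]
      exact Perm.sameCycle_apply_left
    simp only [M, this]
  have hmax : ∀ x, ∃ y, σ.SameCycle x y ∧ M x = v y := by
    intro x
    obtain ⟨y, hy, h⟩ := Finset.exists_mem_eq_sup (S x)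
      ⟨x, Finset.mem_filter.2 ⟨Finset.mem_univ _, Perm.SameCycle.refl _ _⟩⟩ v
    exact ⟨y, (Finset.mem_filter.1 hy).2, h⟩
  refine ⟨fun x => (M x : ℝ) - M (-x), fun x => ?_, fun x => ?_, fun x hx => ?_⟩
  · simp only [neg_neg, neg_sub]
  · simp only [← hσ, hM]
  · obtain ⟨y, hy, hyM⟩ := hmax x
    obtain ⟨z, hz, hzM⟩ := hmax (-x)
    have h : M x = M (-x) := by exact_mod_cast sub_eq_zero.1 hx
    have hyz : y = z := by
      rw [hyM, hzM] at h
      have h1 := y.2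
      have h2 := z.2
      simp only [v] at h
      exact Subtype.ext (by omega)
    rw [hyz] at hy
    exact hy.trans hz.symm

/-- The functions that vanish on the cycles `c` with `c = -c`. -/
def vanishing (σ : Perm (PM n)) : Submodule ℝ (PM n → ℝ) where
  carrier := {f | ∀ x, σ.SameCycle x (-x) → f x = 0}
  zero_mem' _ _ := rfl
  add_mem' hf hg x hx := by simp only [Pi.add_apply, hf x hx, hg x hx, add_zero]
  smul_mem' c f hf x hx := by simp only [Pi.smul_apply, hf x hx, smul_zero]

/-- The dimension of the space of invariant even functions. -/
noncomputable def evenDim (σ : Perm (PM n)) : ℕ :=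
  finrank ℝ (evenFun n ⊓ inv σ : Submodule ℝ (PM n → ℝ))

theorem evenDim_one : evenDim (1 : Perm (PM n)) = finrank ℝ (evenFun n) := by
  rw [evenDim, inv_one, inf_top_eq]

/-- Products with a nowhere vanishing odd function are even. -/
theorem finrank_even_le_odd : finrank ℝ (evenFun n) ≤ finrank ℝ (oddFun n) := by
  let μ : (PM n → ℝ) →ₗ[ℝ] (PM n → ℝ) := LinearMap.mulLeft ℝ (fun x : PM n => (x.1 : ℝ))
  refine LinearMap.finrank_le_finrank_of_injective (f := μ.restrict (p := evenFun n)
    (q := oddFun n) fun f hf x => ?_) fun f g h => Subtype.ext (funext fun x => ?_)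
  · change ((-x).1 : ℝ) * f (-x) = -((x.1 : ℝ) * f x)
    rw [hf, neg_val]
    push_cast
    ring
  · have h' : (x.1 : ℝ) * f.1 x = (x.1 : ℝ) * g.1 x := congrFun (congrArg Subtype.val h) x
    exact mul_left_cancel₀ (Int.cast_ne_zero.2 x.2.1) h'

/-- Multiplication by the function of `exists_odd_invariant` embeds the odd invariants into the even
ones, since odd invariants vanish on balanced cycles. The image vanishes there too, so it meets `G`
only inside `vanishing σ`. Thus functions in `G` that are detected on balanced cycles witness the
excess of `evenDim` over `oddDim`. -/
theorem oddDim_add_finrank_le (σ : Perm (PM n)) (hσ : ∀ i, σ (-i) = -σ i)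
    (G : Submodule ℝ (PM n → ℝ)) (hG : G ≤ evenFun n ⊓ inv σ) :
    oddDim σ + finrank ℝ G ≤
      evenDim σ + finrank ℝ (G ⊓ vanishing σ : Submodule ℝ (PM n → ℝ)) := by
  obtain ⟨a, ha, ha', ha0⟩ := exists_odd_invariant σ hσ
  set O : Submodule ℝ (PM n → ℝ) := oddFun n ⊓ inv σ
  have hO : ∀ f ∈ O, f ∈ vanishing σ := by
    intro f hf x hx
    have h1 := apply_eq_of_sameCycle hf.2 hx
    have h2 := hf.1 x
    linarith
  let μ : O →ₗ[ℝ] (PM n → ℝ) := (LinearMap.mulLeft ℝ a).domRestrict O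
  have hμ : ∀ f x, μ f x = a x * f.1 x := fun _ _ => rfl
  have hinj : Function.Injective μ := by
    intro f g h
    refine Subtype.ext (funext fun x => ?_)
    have h' := congrFun h x
    rw [hμ, hμ] at h'
    by_cases hx : a x = 0
    · rw [hO _ f.2 x (ha0 x hx), hO _ g.2 x (ha0 x hx)]
    · exact mul_left_cancel₀ hx h'
  have h1 := LinearMap.finrank_range_of_inj hinj
  have h2 := Submodule.finrank_sup_add_finrank_inf_eq (LinearMap.range μ) G
  have h3 : LinearMap.range μ ≤ evenFun n ⊓ inv σ := by
    rintro _ ⟨f, rfl⟩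
    refine ⟨fun x => ?_, fun x => ?_⟩
    · rw [hμ, hμ, ha, f.2.1]; ring
    · rw [hμ, hμ, ha', f.2.2]
  have h4 : finrank ℝ (LinearMap.range μ ⊔ G : Submodule ℝ (PM n → ℝ)) ≤ evenDim σ :=
    Submodule.finrank_mono (sup_le h3 hG)
  have h5 : finrank ℝ (LinearMap.range μ ⊓ G : Submodule ℝ (PM n → ℝ)) ≤
      finrank ℝ (G ⊓ vanishing σ : Submodule ℝ (PM n → ℝ)) := by
    refine Submodule.finrank_mono ?_
    rintro _ ⟨⟨f, rfl⟩, hf⟩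
    refine ⟨hf, fun x hx => ?_⟩
    rw [hμ, hO _ f.2 x hx, mul_zero]
  change finrank ℝ O + _ ≤ _
  omega

theorem finrank_even_eq_odd : finrank ℝ (evenFun n) = finrank ℝ (oddFun n) := by
  refine le_antisymm finrank_even_le_odd ?_
  have := oddDim_add_finrank_le (1 : Perm (PM n)) (fun _ => rfl) ⊥ bot_le
  rw [bot_inf_eq, finrank_bot, evenDim_one, oddDim_one] at this
  exact this

/-- Negation carries the action of `ρ` on `{a > 0}` to its action on `{a < 0}`, so `ρ` is a product
of two conjugate permutations, and the signs cancel. -/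
theorem sign_eq_one_of_odd_invariant {ρ : Perm (PM n)} (hρ : ∀ i, ρ (-i) = -ρ i)
    {a : PM n → ℝ} (ha : a ∈ oddFun n) (ha' : a ∈ inv ρ) (h0 : ∀ x, a x = 0 → ρ x = x) :
    Perm.sign ρ = 1 := by
  classical
  have hst : ∀ x, 0 < a (ρ x) ↔ 0 < a x := fun x => by rw [ha' x]
  let ν : Perm (PM n) := Equiv.neg (PM n)
  let ρ' : Perm (PM n) := Perm.ofSubtype (ρ.subtypePerm (p := fun x => 0 < a x) hst)
  have hpos : ∀ x, 0 < a x → ρ' x = ρ x := fun x hx =>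
    Perm.ofSubtype_apply_of_mem (ρ.subtypePerm hst) hx
  have hnonpos : ∀ x, ¬ 0 < a x → ρ' x = x := fun x hx =>
    Perm.ofSubtype_apply_of_not_mem (ρ.subtypePerm hst) hx
  have hconj : ∀ x, (ν * ρ' * ν⁻¹) x = -ρ' (-x) := fun x => rfl
  have h : ρ = ρ' * (ν * ρ' * ν⁻¹) := by
    ext1 x
    rw [Perm.mul_apply, hconj]
    rcases lt_trichotomy (a x) 0 with hx | hx | hx
    · rw [hpos (-x) (by rw [ha]; linarith), hρ, neg_neg, hnonpos]
      rw [ha']; linarith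
    · rw [hnonpos (-x) (by rw [ha]; linarith), neg_neg, hnonpos x (by linarith), h0 x hx]
    · rw [hnonpos (-x) (by rw [ha]; linarith), neg_neg, hpos x hx]
  rw [h, map_mul, map_mul, map_mul, mul_right_comm (Perm.sign ν), map_inv, mul_inv_cancel, one_mul,
    Int.units_mul_self]

/-- Without balanced cycles in `P`, the restrictions of `σ` and `τ` to `P`, extended by the
identity, would both be even, and so would their product `ρ`. -/
theorem exists_sameCycle_neg {σ τ ρ : Perm (PM n)} (P : PM n → Prop) (hP : ∀ x, P (-x) ↔ P x)
    (hPσ : ∀ x, P (σ x) ↔ P x) (hPτ : ∀ x, P (τ x) ↔ P x)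
    (hσ : ∀ i, σ (-i) = -σ i) (hτ : ∀ i, τ (-i) = -τ i)
    (hρ : ∀ x, P x → ρ x = σ (τ x)) (hρ' : ∀ x, ¬ P x → ρ x = x) (hs : Perm.sign ρ = -1) :
    ∃ x, P x ∧ (σ.SameCycle x (-x) ∨ τ.SameCycle x (-x)) := by
  classical
  by_contra! hno
  have key : ∀ κ : Perm (PM n), ∀ hκ : (∀ x, P (κ x) ↔ P x), (∀ i, κ (-i) = -κ i) →
      (∀ x, P x → ¬ κ.SameCycle x (-x)) →
      Perm.sign (Perm.ofSubtype (κ.subtypePerm (p := P) hκ)) = 1 := by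
    intro κ hκ hneg hb
    obtain ⟨a, ha, ha', ha0⟩ := exists_odd_invariant κ hneg
    have h1 : ∀ x, P x → Perm.ofSubtype (κ.subtypePerm (p := P) hκ) x = κ x :=
      fun x hx => Perm.ofSubtype_apply_of_mem _ hx
    have h2 : ∀ x, ¬ P x → Perm.ofSubtype (κ.subtypePerm (p := P) hκ) x = x :=
      fun x hx => Perm.ofSubtype_apply_of_not_mem _ hx
    refine sign_eq_one_of_odd_invariant (a := fun x => if P x then a x else 0) ?_ ?_ ?_ ?_
    · intro x
      by_cases hx : P x
      · rw [h1 _ ((hP x).2 hx), h1 x hx, hneg]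
      · rw [h2 _ (fun h => hx ((hP x).1 h)), h2 x hx]
    · intro x
      by_cases hx : P x
      · simp only [hP, hx, if_true, ha x]
      · simp only [hP, hx, if_false, neg_zero]
    · intro x
      by_cases hx : P x
      · simp only [h1 x hx, hκ, ha' x]
      · simp only [h2 x hx]
    · intro x hx
      by_cases hPx : P x
      · simp only [hPx, if_true] at hx
        exact absurd (ha0 x hx) (hb x hPx)
      · exact h2 x hPx
  have hprod : ρ = Perm.ofSubtype (σ.subtypePerm (p := P) hPσ) *
      Perm.ofSubtype (τ.subtypePerm (p := P) hPτ) := by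
    ext1 x
    rw [Perm.mul_apply]
    by_cases hx : P x
    · rw [hρ x hx, Perm.ofSubtype_apply_of_mem (τ.subtypePerm hPτ) hx]
      exact (Perm.ofSubtype_apply_of_mem (σ.subtypePerm hPσ) ((hPτ x).2 hx)).symm
    · rw [hρ' x hx, Perm.ofSubtype_apply_of_not_mem (τ.subtypePerm hPτ) hx,
        Perm.ofSubtype_apply_of_not_mem (σ.subtypePerm hPσ) hx]
  rw [hprod, map_mul, key σ hPσ hσ fun x hx => (hno x hx).1,
    key τ hPτ hτ fun x hx => (hno x hx).2] at hs
  exact absurd hs (by decide)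

end balanced

/-! ### Signed cycles -/

section signedCycle

variable {m : ℕ} {a : Fin m → PM n}

theorem signedCycle_apply_of_ne {x : PM n} (h : ∀ i, x ≠ a i ∧ x ≠ -a i) :
    signedCycle a x = x := by
  refine List.formPerm_apply_of_notMem ?_
  simp only [List.mem_append, List.mem_ofFn', Set.mem_range, not_or, not_exists]
  exact ⟨fun i hi => (h i).1 hi.symm, fun i hi => (h i).2 hi.symm⟩

theorem sameCycle_signedCycle (hm : 0 < m) (ha : Function.Injective a) (hpos : ∀ i, 0 < (a i).1)
    {x y : PM n} (hx : ∃ i, x = a i ∨ x = -a i) (hy : ∃ i, y = a i ∨ y = -a i) :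
    (signedCycle a).SameCycle x y := by
  have hnd := signedCycle_aux a ha hpos
  have hc := List.isCycle_formPerm hnd (by simp; omega)
  have hs := List.support_formPerm_of_nodup _ hnd (by
    intro x hx
    have := congrArg List.length hx
    simp at this
    omega)
  have hne : ∀ z, (∃ i, z = a i ∨ z = -a i) → signedCycle a z ≠ z := by
    rintro z ⟨i, hi⟩
    rw [← Perm.mem_support]
    unfold signedCycle
    rw [hs, List.mem_toFinset, List.mem_append, List.mem_ofFn', List.mem_ofFn']
    exact hi.imp (fun h => ⟨i, h.symm⟩) (fun h => ⟨i, h.symm⟩)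
  exact hc.sameCycle (hne x hx) (hne y hy)

end signedCycle

/-! ### The two cycles of `γ` and its invariants -/

section gamma

variable {p q : ℕ}

theorem exists_castAdd_iff (x : PM (p + q)) :
    (∃ i : Fin p, x = pos (Fin.castAdd q i) ∨ x = -pos (Fin.castAdd q i)) ↔ |x.1| ≤ p := by
  have h0 := x.2
  constructor
  · rintro ⟨i, h | h⟩ <;> have := congrArg Subtype.val h <;>
      simp only [neg_val, pos, Fin.val_castAdd] at this <;> rw [abs_le] <;> omega
  · intro h
    rw [abs_le] at h
    rcases lt_or_gt_of_ne h0.1 with hx | hx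
    · exact ⟨⟨(-x.1 - 1).toNat, by omega⟩, Or.inr (Subtype.ext (by
        simp only [neg_val, pos, Fin.val_castAdd]; omega))⟩
    · exact ⟨⟨(x.1 - 1).toNat, by omega⟩, Or.inl (Subtype.ext (by
        simp only [pos, Fin.val_castAdd]; omega))⟩

theorem exists_natAdd_iff (x : PM (p + q)) :
    (∃ i : Fin q, x = pos (Fin.natAdd p i) ∨ x = -pos (Fin.natAdd p i)) ↔ ¬ |x.1| ≤ p := by
  have h0 := x.2
  constructor
  · rintro ⟨i, h | h⟩ <;> have := congrArg Subtype.val h <;>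
      simp only [neg_val, pos, Fin.val_natAdd] at this <;> rw [abs_le] <;> omega
  · intro h
    rw [abs_le] at h
    rcases lt_or_gt_of_ne h0.1 with hx | hx
    · exact ⟨⟨(-x.1 - 1 - p).toNat, by omega⟩, Or.inr (Subtype.ext (by
        simp only [neg_val, pos, Fin.val_natAdd]; omega))⟩
    · exact ⟨⟨(x.1 - 1 - p).toNat, by omega⟩, Or.inl (Subtype.ext (by
        simp only [pos, Fin.val_natAdd]; omega))⟩

theorem pos_injective (n : ℕ) : Function.Injective (pos : Fin n → PM n) := by
  intro i j h
  have := congrArg Subtype.val h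
  simp only [pos] at this
  exact Fin.ext (by omega)

theorem pos_castAdd_injective :
    Function.Injective (fun i : Fin p => (pos (Fin.castAdd q i) : PM (p + q))) :=
  (pos_injective _).comp (Fin.castAdd_injective p q)

theorem pos_natAdd_injective :
    Function.Injective (fun i : Fin q => (pos (Fin.natAdd p i) : PM (p + q))) :=
  (pos_injective _).comp (Fin.natAdd_injective q p)

theorem pos_val_pos (i : Fin n) : 0 < (pos i).1 := by simp only [pos]; omega

/-- The first cycle of `γ`. -/
def innerCycle (p q : ℕ) : Perm (PM (p + q)) :=
  signedCycle (fun i : Fin p => pos (Fin.castAdd q i))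

/-- The second cycle of `γ`. -/
def outerCycle (p q : ℕ) : Perm (PM (p + q)) :=
  signedCycle (fun i : Fin q => pos (Fin.natAdd p i))

theorem innerCycle_apply_of_lt {x : PM (p + q)} (hx : ¬ |x.1| ≤ p) : innerCycle p q x = x :=
  signedCycle_apply_of_ne fun i =>
    ⟨fun h => hx ((exists_castAdd_iff x).1 ⟨i, Or.inl h⟩),
      fun h => hx ((exists_castAdd_iff x).1 ⟨i, Or.inr h⟩)⟩

theorem outerCycle_apply_of_le {x : PM (p + q)} (hx : |x.1| ≤ p) : outerCycle p q x = x :=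
  signedCycle_apply_of_ne fun i =>
    ⟨fun h => (exists_natAdd_iff x).1 ⟨i, Or.inl h⟩ hx,
      fun h => (exists_natAdd_iff x).1 ⟨i, Or.inr h⟩ hx⟩

theorem abs_outerCycle_le_iff (x : PM (p + q)) : |(outerCycle p q x).1| ≤ p ↔ |x.1| ≤ p := by
  refine ⟨fun h => ?_, fun h => by rwa [outerCycle_apply_of_le h]⟩
  rwa [(outerCycle p q).injective (outerCycle_apply_of_le h)] at h

theorem abs_innerCycle_le_iff (x : PM (p + q)) : |(innerCycle p q x).1| ≤ p ↔ |x.1| ≤ p := by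
  refine not_iff_not.1 ⟨fun h => ?_, fun h => by rwa [innerCycle_apply_of_lt h]⟩
  rwa [(innerCycle p q).injective (innerCycle_apply_of_lt h)] at h

theorem gamma_apply_of_le {x : PM (p + q)} (hx : |x.1| ≤ p) : gamma p q x = innerCycle p q x := by
  change innerCycle p q (outerCycle p q x) = _
  rw [outerCycle_apply_of_le hx]

theorem gamma_apply_of_lt {x : PM (p + q)} (hx : ¬ |x.1| ≤ p) :
    gamma p q x = outerCycle p q x := by
  change innerCycle p q (outerCycle p q x) = _
  rw [innerCycle_apply_of_lt fun h => hx ((abs_outerCycle_le_iff x).1 h)]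

theorem abs_gamma_le_iff (x : PM (p + q)) : |(gamma p q x).1| ≤ p ↔ |x.1| ≤ p := by
  change |(innerCycle p q (outerCycle p q x)).1| ≤ p ↔ _
  rw [abs_innerCycle_le_iff, abs_outerCycle_le_iff]

theorem sign_innerCycle (hp : 0 < p) : Perm.sign (innerCycle p q) = -1 :=
  sign_signedCycle hp _ pos_castAdd_injective fun _ => pos_val_pos _

theorem sign_outerCycle (hq : 0 < q) : Perm.sign (outerCycle p q) = -1 :=
  sign_signedCycle hq _ pos_natAdd_injective fun _ => pos_val_pos _

theorem eq_of_mem_inv_gamma (hp : 0 < p) (hq : 0 < q) {f : PM (p + q) → ℝ}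
    (hf : f ∈ inv (gamma p q)) {x y : PM (p + q)} (h : |x.1| ≤ p ↔ |y.1| ≤ p) : f x = f y := by
  by_cases hx : |x.1| ≤ p
  · refine apply_eq_of_sameCycle (σ := innerCycle p q) (fun z => ?_)
      (sameCycle_signedCycle hp pos_castAdd_injective (fun _ => pos_val_pos _)
        ((exists_castAdd_iff x).2 hx) ((exists_castAdd_iff y).2 (h.1 hx)))
    by_cases hz : |z.1| ≤ p
    · rw [← gamma_apply_of_le hz, hf]
    · rw [innerCycle_apply_of_lt hz]
  · refine apply_eq_of_sameCycle (σ := outerCycle p q) (fun z => ?_)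
      (sameCycle_signedCycle hq pos_natAdd_injective (fun _ => pos_val_pos _)
        ((exists_natAdd_iff x).2 hx) ((exists_natAdd_iff y).2 fun hy => hx (h.2 hy)))
    by_cases hz : |z.1| ≤ p
    · rw [outerCycle_apply_of_le hz]
    · rw [← gamma_apply_of_lt hz, hf]

/-- The function with value `s` on the first cycle of `γ` and `t` on the second. -/
noncomputable def twoValued (p q : ℕ) (s t : ℝ) : PM (p + q) → ℝ :=
  fun x => if |x.1| ≤ p then s else t

theorem twoValued_mem (s t : ℝ) : twoValued p q s t ∈ inv (gamma p q) := fun x => by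
  simp only [twoValued, abs_gamma_le_iff]

theorem exists_inner_outer (hp : 0 < p) (hq : 0 < q) :
    ∃ x y : PM (p + q), |x.1| ≤ p ∧ ¬ |y.1| ≤ p :=
  ⟨_, _, (exists_castAdd_iff _).1 ⟨⟨0, hp⟩, Or.inl rfl⟩,
    (exists_natAdd_iff _).1 ⟨⟨0, hq⟩, Or.inl rfl⟩⟩

theorem finrank_inv_gamma (hp : 0 < p) (hq : 0 < q) : finrank ℝ (inv (gamma p q)) = 2 := by
  obtain ⟨x, y, hx, hy⟩ := exists_inner_outer hp hq
  let φ : inv (gamma p q) →ₗ[ℝ] ℝ × ℝ :=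
    ((LinearMap.proj (R := ℝ) (φ := fun _ : PM (p + q) => ℝ) x).prod
      (LinearMap.proj (R := ℝ) (φ := fun _ : PM (p + q) => ℝ) y)).domRestrict _
  have hφ : ∀ f, φ f = (f.1 x, f.1 y) := fun _ => rfl
  have hbij : Function.Bijective φ := by
    constructor
    · intro f g h
      rw [hφ, hφ, Prod.mk.injEq] at h
      refine Subtype.ext (funext fun z => ?_)
      by_cases hz : |z.1| ≤ p
      · rw [eq_of_mem_inv_gamma hp hq f.2 (iff_of_true hz hx),
          eq_of_mem_inv_gamma hp hq g.2 (iff_of_true hz hx), h.1]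
      · rw [eq_of_mem_inv_gamma hp hq f.2 (iff_of_false hz hy),
          eq_of_mem_inv_gamma hp hq g.2 (iff_of_false hz hy), h.2]
    · rintro ⟨s, t⟩
      refine ⟨⟨_, twoValued_mem s t⟩, ?_⟩
      rw [hφ]
      simp only [twoValued, hx, hy, if_true, if_false]
  rw [(LinearEquiv.ofBijective φ hbij).finrank_eq, finrank_prod, finrank_self]

theorem inv_gamma_le_even (hp : 0 < p) (hq : 0 < q) : inv (gamma p q) ≤ evenFun (p + q) :=
  fun _ hf x => eq_of_mem_inv_gamma hp hq hf (by rw [neg_val, abs_neg])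

theorem odd_inf_inv_gamma (hp : 0 < p) (hq : 0 < q) : oddFun (p + q) ⊓ inv (gamma p q) = ⊥ := by
  rw [eq_bot_iff]
  rintro f ⟨h1, h2⟩
  ext x
  have h3 := h1 x
  have h4 := inv_gamma_le_even hp hq h2 x
  change f x = 0
  linarith

/-- If every cycle of `γ` is invariant under `τ`, then each of them contains a cycle `c = -c` of
`τ` or of `τ⁻¹ γ`. -/
theorem inv_gamma_inf_vanishing (hp : 0 < p) (hq : 0 < q) {τ : Perm (PM (p + q))}
    (hτ : ∀ i, τ (-i) = -τ i) (hle : inv (gamma p q) ≤ inv τ) :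
    inv (gamma p q) ⊓ (vanishing τ ⊓ vanishing (τ⁻¹ * gamma p q)) = ⊥ := by
  have hγ := (gamma_mem_D hp hq).1
  have hPτ : ∀ x, |(τ x).1| ≤ p ↔ |x.1| ≤ p := by
    intro x
    -- The indicator of the first cycle of `γ` is `τ`-invariant, so `τ` preserves both cycles as
    -- sets.
    have h := hle (twoValued_mem (p := p) (q := q) 1 0) x
    simp only [twoValued] at h
    split_ifs at h with h1 h2 h2
    exacts [iff_of_true h1 h2, absurd h one_ne_zero, absurd h zero_ne_one, iff_of_false h1 h2]
  have hPκ : ∀ x, |((τ⁻¹ * gamma p q) x).1| ≤ p ↔ |x.1| ≤ p := by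
    intro x
    rw [← hPτ, ← Perm.mul_apply, mul_inv_cancel_left, abs_gamma_le_iff]
  have hκ : ∀ i, (τ⁻¹ * gamma p q) (-i) = -(τ⁻¹ * gamma p q) i := by
    intro i
    rw [Perm.mul_apply, hγ, commute_neg_inv hτ, Perm.mul_apply]
  have hmul : ∀ x, τ ((τ⁻¹ * gamma p q) x) = gamma p q x := fun x => by
    rw [← Perm.mul_apply, mul_inv_cancel_left]
  obtain ⟨x, hx, hx'⟩ := exists_sameCycle_neg (ρ := innerCycle p q) (fun x => |x.1| ≤ p)
    (fun x => by rw [neg_val, abs_neg]) hPτ hPκ hτ hκ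
    (fun x hx => by rw [hmul, gamma_apply_of_le hx]) (fun x hx => innerCycle_apply_of_lt hx)
    (sign_innerCycle hp)
  obtain ⟨y, hy, hy'⟩ := exists_sameCycle_neg (ρ := outerCycle p q) (fun x => ¬ |x.1| ≤ p)
    (fun x => by rw [neg_val, abs_neg]) (fun x => not_congr (hPτ x)) (fun x => not_congr (hPκ x))
    hτ hκ (fun x hx => by rw [hmul, gamma_apply_of_lt hx])
    (fun x hx => outerCycle_apply_of_le (not_not.1 hx)) (sign_outerCycle hq)
  rw [eq_bot_iff]
  rintro f ⟨hf, hf1, hf2⟩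
  have hfx : f x = 0 := hx'.elim (hf1 x) (hf2 x)
  have hfy : f y = 0 := hy'.elim (hf1 y) (hf2 y)
  ext z
  by_cases hz : |z.1| ≤ p
  · exact (eq_of_mem_inv_gamma hp hq hf (iff_of_true hz hx)).trans hfx
  · exact (eq_of_mem_inv_gamma hp hq hf (iff_of_false hz hy)).trans hfy

/-- Apply `oddDim_add_finrank_le` to both factors with `G` the two-dimensional space `inv (gamma p
q)`. The two error terms come from subspaces of `G` with zero intersection, so together they take
back at most 2 of the 4 dimensions. -/
theorem le_evenDim_add_evenDim (hp : 0 < p) (hq : 0 < q) {τ : Perm (PM (p + q))}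
    (hτ : ∀ i, τ (-i) = -τ i) (hle : inv (gamma p q) ≤ inv τ) :
    oddDim τ + oddDim (τ⁻¹ * gamma p q) + 2 ≤ evenDim τ + evenDim (τ⁻¹ * gamma p q) := by
  have hγ := (gamma_mem_D hp hq).1
  have hκ : ∀ i, (τ⁻¹ * gamma p q) (-i) = -(τ⁻¹ * gamma p q) i := by
    intro i
    rw [Perm.mul_apply, hγ, commute_neg_inv hτ, Perm.mul_apply]
  have heven := inv_gamma_le_even hp hq
  have hle' : inv (gamma p q) ≤ inv (τ⁻¹ * gamma p q) := fun f hf x => by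
    rw [Perm.mul_apply, apply_inv_of_mem_inv (hle hf), hf]
  have h1 := oddDim_add_finrank_le τ hτ _ (le_inf heven hle)
  have h2 := oddDim_add_finrank_le _ hκ _ (le_inf heven hle')
  have h3 := Submodule.finrank_sup_add_finrank_inf_eq (inv (gamma p q) ⊓ vanishing τ)
    (inv (gamma p q) ⊓ vanishing (τ⁻¹ * gamma p q))
  rw [← inf_inf_distrib_left, inv_gamma_inf_vanishing hp hq hτ hle, finrank_bot] at h3
  have h4 : finrank ℝ (inv (gamma p q) ⊓ vanishing τ ⊔
      inv (gamma p q) ⊓ vanishing (τ⁻¹ * gamma p q) : Submodule ℝ (PM (p + q) → ℝ)) ≤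
      finrank ℝ (inv (gamma p q)) :=
    Submodule.finrank_mono (sup_le inf_le_left inf_le_left)
  rw [finrank_inv_gamma hp hq] at h1 h2 h4
  omega

end gamma

/-! ### Comparison of the genus and length conditions -/

/-- An even signed permutation is non-crossing iff its length and that of its complement add up
to the length of `γ`. -/
theorem mem_Snc_gamma_iff {p q : ℕ} (hp : 0 < p) (hq : 0 < q) {τ : Perm (PM (p + q))}
    (hτ : ∀ i, τ (-i) = -τ i) :
    τ ∈ Snc (PM (p + q)) (gamma p q) ↔
      oddDim τ + oddDim (τ⁻¹ * gamma p q) = finrank ℝ (oddFun (p + q)) := by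
  set γ := gamma p q with hγdef
  set κ := τ⁻¹ * γ with hκdef
  have hγ : ∀ i, γ (-i) = -γ i := (gamma_mem_D hp hq).1
  have hκ : ∀ i, κ (-i) = -κ i := by
    intro i
    rw [hκdef, Perm.mul_apply, hγ, commute_neg_inv hτ, Perm.mul_apply]
  have hτκ : τ * κ = γ := mul_inv_cancel_left τ γ
  have hjoint : inv τ ⊓ inv κ = inv τ ⊓ inv γ := by rw [← inv_inf_inv_mul, hτκ]
  have hE := finrank_inv_add_le τ κ (evenFun (p + q)) fun f hf x => by
    change f (κ⁻¹ (-x)) = f (κ⁻¹ x)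
    rw [commute_neg_inv hκ, hf]
  have hO := finrank_inv_add_le τ κ (oddFun (p + q)) fun f hf x => by
    change f (κ⁻¹ (-x)) = -f (κ⁻¹ x)
    rw [commute_neg_inv hκ, hf]
  rw [hτκ, hjoint] at hE hO
  have heven : inv γ ≤ evenFun (p + q) := inv_gamma_le_even hp hq
  rw [inf_eq_right.2 heven, inf_eq_right.2 (inf_le_right.trans heven),
    finrank_inv_gamma hp hq] at hE
  have hO0 : oddFun (p + q) ⊓ (inv τ ⊓ inv γ) = ⊥ :=
    eq_bot_iff.2 ((inf_le_inf_left _ inf_le_right).trans (odd_inf_inv_gamma hp hq).le)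
  rw [odd_inf_inv_gamma hp hq, hO0, finrank_bot] at hO
  have hsplit : ∀ σ : Perm (PM (p + q)), (∀ i, σ (-i) = -σ i) →
      numOrbits σ = evenDim σ + oddDim σ := fun σ hσ => by
    rw [← finrank_inv]
    exact finrank_eq_even_add_odd _ (inv_comp_neg hσ)
  have hcard : Fintype.card (PM (p + q)) =
      finrank ℝ (oddFun (p + q)) + finrank ℝ (oddFun (p + q)) := by
    have h := finrank_eq_even_add_odd (⊤ : Submodule ℝ (PM (p + q) → ℝ)) fun _ _ => trivial
    rwa [inf_top_eq, inf_top_eq, finrank_top, finrank_fintype_fun_eq_card,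
      finrank_even_eq_odd] at h
  have hk : finrank ℝ (inv τ ⊓ inv γ : Submodule ℝ (PM (p + q) → ℝ)) ≤ 2 :=
    (Submodule.finrank_mono inf_le_right).trans (finrank_inv_gamma hp hq).le
  have hbound : ∀ σ : Perm (PM (p + q)), (∀ i, σ (-i) = -σ i) → oddDim σ ≤ evenDim σ :=
    fun σ hσ => by
      have := oddDim_add_finrank_le σ hσ ⊥ bot_le
      rwa [bot_inf_eq, finrank_bot] at this
  -- Two joint orbits mean that every `γ`-invariant function is `τ`-invariant.
  have h2 : finrank ℝ (inv τ ⊓ inv γ : Submodule ℝ (PM (p + q) → ℝ)) = 2 →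
      oddDim τ + oddDim κ + 2 ≤ evenDim τ + evenDim κ := fun h =>
    le_evenDim_add_evenDim hp hq hτ (inf_eq_right.1 (Submodule.eq_of_le_of_finrank_le inf_le_right
      (by rw [h, finrank_inv_gamma hp hq])))
  change numOrbits τ + numOrbits κ + numOrbits γ = _ + 2 * numJointOrbits τ γ ↔ _
  rw [← finrank_inv γ, finrank_inv_gamma hp hq, ← finrank_inv_inf_inv, hsplit τ hτ, hsplit κ hκ,
    hcard]
  rw [finrank_even_eq_odd] at hE
  have h3 := hbound τ hτ
  have h4 := hbound κ hκ
  change evenDim τ + evenDim κ + 2 ≤ _ at hE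
  change oddDim τ + oddDim κ + 0 ≤ _ at hO
  constructor
  · intro h
    omega
  · intro h
    -- With fewer than two joint orbits, `hE` bounds the even sum by N, while `h3` and `h4` bound it
    -- below by the odd sum N. With two, `hE` gives the upper bound N + 2 and `h2` the matching
    -- lower bound.
    rcases hk.lt_or_eq with hk | hk
    · omega
    · have := h2 hk
      omega

end AnnularD

theorem corollary7p1 (p q : ℕ) (hp : 0 < p) (hq : 0 < q) :
    AnnularD.SDnc p q =
      {τ : Equiv.Perm (AnnularD.PM (p + q)) | ∃ h : τ ∈ AnnularD.D (p + q),
        AnnularD.leD ⟨τ, h⟩ (AnnularD.gammaD p q hp hq)} := by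
  open AnnularD in
  ext τ
  have key : ∀ h : τ ∈ D (p + q), τ ∈ Snc (PM (p + q)) (gamma p q) ↔
      leD ⟨τ, h⟩ (gammaD p q hp hq) := by
    intro h
    have h1 : lengthD (⟨τ, h⟩ : D (p + q)) + oddDim τ = _ := lengthD_add_oddDim _
    have h2 : lengthD ((⟨τ, h⟩ : D (p + q))⁻¹ * gammaD p q hp hq) + oddDim (τ⁻¹ * gamma p q) = _ :=
      lengthD_add_oddDim _
    have h3 : lengthD (gammaD p q hp hq) + oddDim (gamma p q) = _ := lengthD_add_oddDim _
    rw [oddDim, odd_inf_inv_gamma hp hq, finrank_bot] at h3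
    rw [mem_Snc_gamma_iff hp hq h.1, leD]
    omega
  exact ⟨fun h => ⟨h.2, (key h.2).1 h.1⟩, fun ⟨h, h'⟩ => ⟨(key h).2 h', h⟩⟩
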